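/- Let $m\ge 2$, $n_1,\dots,n_m\ge 1$, $n=n_1+\cdots+n_m$, and consider the interconnected system $$\dot x_i=f_i(t,x_1,\dots,x_m),\quad t\ge t_0,\qquad i=1,\dots,m,\qquad x_i\in\mathbb R^{n_i},$$ i.e. $\dot x=f(t,x)$ with $x=(x_1,\dots,x_m)\in\mathbb R^n$ and $f=(f_1,\dots,f_m)$. Assume that $f$ is piecewise continuous in $t$ for every fixed $x$ (finitely many discontinuities in each bounded interval, with one-sided limits), continuously differentiable in $x$ for every $t\ge t_0$, with Jacobian matrix $\partial f/\partial x$ bounded on compact subsets of $[t_0,\infty)\times\mathbb R^n$, and that the system is forward complete: for every $s\ge t_0$ and $x\in\mathbb R^n$ the (absolutely continuous, then unique) solution $t\mapsto\xi(t,s,x)$ with $\xi(s,s,x)=x$ exists on $[s,\infty)$. Put $\xi(t,s,S)=\{\xi(t,s,x):x\in S\}$, and let $\operatorname{co}$ denote the convex hull. Let $K\subset\mathbb R^n$ be compact with nonempty interior and let $|\cdot|$ be any norm on $\mathbb R^n$. The topological entropy is $$h(f,t_0,K)=\lim_{\varepsilon\searrow0}\limsup_{T\to\infty}\frac1T\log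 S(f,t_0,\varepsilon,T,K),$$ where $S(f,t_0,\varepsilon,T,K)$ is the minimal cardinality of a set $E\subset K$ such that for every $\bar x\in K$ there is $x\in E$ with $|\xi(t,t_0,\bar x)-\xi(t,t_0,x)|<\varepsilon$ for all $t\in[t_0,t_0+T]$. Let $|\cdot|_i$ be any norm on $\mathbb R^{n_i}$ for each $i$, and let $|\cdot|_{\mathrm N}$ be any norm on $\mathbb R^m$ that is monotone, i.e. $v\ge w\ge0$ entrywise implies $|v|_{\mathrm N}\ge|w|_{\mathrm N}$. Let $\|A\|_{ij}=\max_{|v|_j=1}|Av|_i$ for $A\in\mathbb R^{n_i\times n_j}$, and let $\mu_i$ and $\mu_{\mathrm N}$ be the matrix measures $\mu(A)=\lim_{s\searrow0}(\|I+sA\|-1)/s$ defined with the norms induced by $|\cdot|_i$ and by $|\cdot|_{\mathrm N}$. Define the interconnection matrix function $A_{\mathrm N}(t,x)=[a_{ij}(t,x)]\in\mathbb R^{m\times m}$ by $$a_{ii}(t,x)=\mu_i\Big(\frac{\partial f_i}{\partial x_i}(t,x)\Big),\qquad a_{ij}(t,x)=\Big\|\frac{\partial f_i}{\partial x_j}(t,x)\Big\|_{ij}\quad(i\ne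 j).$$ Then $$h(f,t_0,K)\le n\max\{\hat\mu^*_{\mathrm N},0\},\qquad \hat\mu^*_{\mathrm N}:=\inf_{t_1\ge t_0}\ \limsup_{t\to\infty}\ \max_{v\in\operatorname{co}(\xi(t_1,t_0,K))}\mu_{\mathrm N}\big(A_{\mathrm N}(t,\xi(t,t_1,v))\big),$$ where $h(f,t_0,K)$ and $\hat\mu^*_{\mathrm N}$ are extended real numbers. -/

import Mathlib

open Set Filter Topology MeasureTheory

noncomputable section

namespace TVEntropy

/-! ### Time-varying systems -/

section Systems

variable {E : Type*} [NormedAddCommGroup E] [NormedSpace ℝ E]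

/-- `g` is piecewise continuous on `[t₀, ∞)`: it has finitely many discontinuities in each bounded
interval, and its one-sided limits exist everywhere. -/
structure PiecewiseContinuousFrom (t₀ : ℝ) (g : ℝ → E) : Prop where
  finite_discontinuities :
    ∀ b : ℝ, {t ∈ Icc t₀ b | ¬ ContinuousWithinAt g (Ici t₀) t}.Finite
  right_limit : ∀ t : ℝ, t₀ ≤ t → ∃ l : E, Tendsto g (𝓝[>] t) (𝓝 l)
  left_limit : ∀ t : ℝ, t₀ < t → ∃ l : E, Tendsto g (𝓝[<] t) (𝓝 l)

/-- The standing regularity of the right-hand side of `x' = f (t, x)`, `t ≥ t₀`: piecewise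
continuous in `t`, continuously differentiable in `x`, with the Jacobian bounded on compact sets
of `(t, x)` (which makes `f` locally Lipschitz in `x`, uniformly for `t` in bounded intervals). -/
structure RegularFrom (t₀ : ℝ) (f : ℝ → E → E) : Prop where
  piecewiseContinuous : ∀ x : E, PiecewiseContinuousFrom t₀ (fun t => f t x)
  contDiff : ∀ t : ℝ, t₀ ≤ t → ContDiff ℝ 1 (f t)
  jacobian_bounded : ∀ (b : ℝ) (C : Set E), IsCompact C →
    ∃ L : ℝ, ∀ t ∈ Icc t₀ b, ∀ x ∈ C, ‖fderiv ℝ (f t) x‖ ≤ L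

/-- `φ` is, on `[s, ∞)`, a solution of `x' = f (t, x)` with `φ s = x`, that is, an absolutely
continuous function that satisfies the equation almost everywhere (integral form). -/
def IsSolution (f : ℝ → E → E) (s : ℝ) (x : E) (φ : ℝ → E) : Prop :=
  ∀ t : ℝ, s ≤ t →
    IntervalIntegrable (fun τ => f τ (φ τ)) volume s t ∧
      φ t = x + ∫ τ in s..t, f τ (φ τ)

/-- From every state at every time `s ≥ t₀` there starts a solution that exists on `[s, ∞)`. -/
def ForwardComplete (t₀ : ℝ) (f : ℝ → E → E) : Prop :=
  ∀ s : ℝ, t₀ ≤ s → ∀ x : E, ∃ φ : ℝ → E, IsSolution f s x φ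

open Classical in
/-- The value `ξ(t, s, x)` at time `t` of the solution with state `x` at time `s`
(only meaningful for `t ≥ s`, and if that solution exists on `[s, ∞)`). -/
def flow (f : ℝ → E → E) (t s : ℝ) (x : E) : E :=
  if h : ∃ φ : ℝ → E, IsSolution f s x φ then h.choose t else x

/-- The reachable set `ξ(t, s, K)`. -/
def reachableSet (f : ℝ → E → E) (t s : ℝ) (K : Set E) : Set E :=
  flow f t s '' K

/-! ### Topological entropy -/

/-- `A ⊆ K` is `(T, ε)`-spanning for the initial set `K` at initial time `t₀`, with respect to
the norm `p`. -/
def IsSpanning (p : Seminorm ℝ E) (f : ℝ → E → E) (t₀ ε T : ℝ) (K A : Set E) : Prop :=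
  A ⊆ K ∧ ∀ y ∈ K, ∃ x ∈ A, ∀ t ∈ Icc t₀ (t₀ + T), p (flow f t t₀ y - flow f t t₀ x) < ε

/-- The minimal cardinality `S(f, t₀, ε, T, K)` of a `(T, ε)`-spanning set. -/
def spanningNumber (p : Seminorm ℝ E) (f : ℝ → E → E) (t₀ ε T : ℝ) (K : Set E) : ℕ∞ :=
  ⨅ (A : Set E) (_ : IsSpanning p f t₀ ε T K A), A.encard

/-- The topological entropy
`h(f, t₀, K) = lim_{ε ↘ 0} limsup_{T → ∞} (1 / T) log S(f, t₀, ε, T, K)`. -/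
def topEntropy (p : Seminorm ℝ E) (f : ℝ → E → E) (t₀ : ℝ) (K : Set E) : EReal :=
  limUnder (𝓝[>] (0 : ℝ)) fun ε =>
    limsup (fun T : ℝ => ((1 / T : ℝ) : EReal) *
      ENNReal.log ((spanningNumber p f t₀ ε T K : ℕ∞) : ENNReal)) atTop

end Systems

/-! ### Norms, induced norms and matrix measures -/

/-- A seminorm that is a norm. -/
def IsNorm {V : Type*} [AddCommGroup V] [Module ℝ V] (p : Seminorm ℝ V) : Prop :=
  ∀ v : V, p v = 0 → v = 0

/-- The norm `p` on `ℝ^ι` is monotone on nonnegative vectors. -/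
def IsMonotoneNorm {ι : Type*} (p : Seminorm ℝ (ι → ℝ)) : Prop :=
  ∀ v w : ι → ℝ, 0 ≤ w → w ≤ v → p w ≤ p v

section Matrices

variable {ι κ : Type*} [Fintype ι] [Fintype κ]

/-- The (mixed) induced norm `max {p (A v) | q v = 1}` of a matrix. -/
def inducedNorm (p : Seminorm ℝ (ι → ℝ)) (q : Seminorm ℝ (κ → ℝ)) (A : Matrix ι κ ℝ) : ℝ :=
  sSup {r : ℝ | ∃ v : κ → ℝ, q v = 1 ∧ p (A.mulVec v) = r}

/-- The matrix measure (logarithmic norm) `lim_{t ↘ 0} (‖I + t A‖ - 1) / t`. -/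
def matrixMeasure [DecidableEq ι] (p : Seminorm ℝ (ι → ℝ)) (A : Matrix ι ι ℝ) : ℝ :=
  limUnder (𝓝[>] (0 : ℝ)) fun t => (inducedNorm p p (1 + t • A) - 1) / t

end Matrices

/-! ### Interconnected systems -/

/-- The state space `ℝ^{n₁} × ⋯ × ℝ^{nₘ}` of an interconnection of `m` subsystems. -/
abbrev State {m : ℕ} (n : Fin m → ℕ) : Type :=
  (i : Fin m) → Fin (n i) → ℝ

section Interconnected

variable {m : ℕ} {n : Fin m → ℕ}

/-- The Jacobian matrix `∂f_i / ∂x_j (t, x)`. -/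
def jacobianBlock (f : ℝ → State n → State n) (t : ℝ) (x : State n) (i j : Fin m) :
    Matrix (Fin (n i)) (Fin (n j)) ℝ :=
  Matrix.of fun a b =>
    fderiv ℝ (f t) x (Pi.single j (Pi.single b (1 : ℝ) : Fin (n j) → ℝ)) i a

/-- The interconnection matrix function `A_N(t, x)`, for the local norms `loc i`. -/
def interconnectionMatrix (loc : (i : Fin m) → Seminorm ℝ (Fin (n i) → ℝ))
    (f : ℝ → State n → State n) (t : ℝ) (x : State n) : Matrix (Fin m) (Fin m) ℝ :=
  Matrix.of fun i j =>
    if i = j then matrixMeasure (loc i) (jacobianBlock f t x i i)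
    else inducedNorm (loc i) (loc j) (jacobianBlock f t x i j)

/-- `inf_{t₁ ≥ t₀} limsup_{t → ∞} max_{v ∈ co(ξ(t₁, t₀, K))} μ_N(A_N(t, ξ(t, t₁, v)))`. -/
def muHatStar (net : Seminorm ℝ (Fin m → ℝ))
    (loc : (i : Fin m) → Seminorm ℝ (Fin (n i) → ℝ))
    (f : ℝ → State n → State n) (t₀ : ℝ) (K : Set (State n)) : EReal :=
  ⨅ (t₁ : ℝ) (_ : t₀ ≤ t₁),
    limsup (fun t : ℝ =>
      ⨆ v ∈ convexHull ℝ (reachableSet f t₁ t₀ K),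
        ((matrixMeasure net (interconnectionMatrix loc f t (flow f t t₁ v)) : ℝ) : EReal)) atTop

end Interconnected

end TVEntropy

end

/-! Give the state space the norm `N` that applies the network norm to the vector of local norms.
Blockwise, the growth of `N` under `1 + s • J`, with `J` the Jacobian, is dominated to first order
by the growth of the network norm under `1 + s • A_N`. Monotonicity of the network norm then bounds
the logarithmic norm of `J` by the matrix measure of `A_N` (`logNormLE_aggregateSeminorm`).

If that bound is at most `c ≥ 0` at all large times along all trajectories from a convex set, these
trajectories separate at most like `exp (c t)` (`exists_norm_flow_sub_le_mul_exp`). Convexity is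
needed because the estimate is integrated along the segment joining two initial states.
Differentiability of the flow in the initial state is never established: the difference of two
solutions started `h k • d` apart solves the linearized equation up to an error `o(h k)`, made
negligible by dominated convergence (`eventually_seminorm_le_of_negligible_perturbation`).

Finally, a grid of mesh proportional to `exp (-c T)` has `O(exp (n c T))` cells meeting `K`, so the
entropy is at most `n c` (`topEntropy_le_of_norm_flow_sub_le`), and `c` decreases to the claimed
bound. -/

noncomputable section

namespace TVEntropy

/-! ### Solutions and the flow: uniqueness, boundedness, Lipschitz dependence. -/

section Systems

variable {E : Type*} [NormedAddCommGroup E] [NormedSpace ℝ E]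

/-- The vector field is Lipschitz in the state, uniformly on bounded sets of times and states. -/
theorem RegularFrom.exists_lipschitz [ProperSpace E] {t₀ : ℝ} {f : ℝ → E → E}
    (hf : RegularFrom t₀ f) (b R : ℝ) :
    ∃ L : ℝ, 0 ≤ L ∧ ∀ t ∈ Icc t₀ b, ∀ x ∈ Metric.closedBall (0 : E) R,
      ∀ y ∈ Metric.closedBall (0 : E) R, ‖f t x - f t y‖ ≤ L * ‖x - y‖ := by
  obtain ⟨L, hL⟩ := hf.jacobian_bounded b (Metric.closedBall (0 : E) R) (isCompact_closedBall 0 R)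
  refine ⟨max L 0, le_max_right _ _, fun t ht x hx y hy => ?_⟩
  refine (convex_closedBall (0 : E) R).norm_image_sub_le_of_norm_fderiv_le (𝕜 := ℝ) (f := f t)
    (fun z _ => ((hf.contDiff t ht.1).differentiable one_ne_zero).differentiableAt)
    (fun z hz => (hL t ht z hz).trans (le_max_left _ _)) hy hx

/-- Grönwall's inequality in integral form. -/
theorem le_mul_exp_of_le_add_integral {u : ℝ → ℝ} {a b δ L : ℝ} (hL : 0 ≤ L)
    (hu : ContinuousOn u (Icc a b))
    (h : ∀ t ∈ Icc a b, u t ≤ δ + L * ∫ τ in a..t, u τ) :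
    ∀ t ∈ Icc a b, u t ≤ δ * Real.exp (L * (t - a)) := by
  intro t ht
  have hab : a ≤ b := ht.1.trans ht.2
  have hint : IntervalIntegrable u volume a b :=
    ContinuousOn.intervalIntegrable (by rwa [uIcc_of_le hab])
  have hd : ∀ x ∈ Icc a b, HasDerivWithinAt (fun x => ∫ τ in a..x, u τ) (u x) (Icc a b) x := by
    intro x hx
    have : Fact (x ∈ Icc a b) := ⟨hx⟩
    exact intervalIntegral.integral_hasDerivWithinAt_right
      (hint.mono_set (by
        rw [uIcc_of_le hab, uIcc_of_le hx.1]; exact Icc_subset_Icc_right hx.2))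
      (hu.stronglyMeasurableAtFilter_nhdsWithin measurableSet_Icc x) (hu x hx)
  have hd' : ∀ x ∈ Icc a b, HasDerivWithinAt (fun x => δ + L * ∫ τ in a..x, u τ) (L * u x)
      (Icc a b) x := fun x hx => ((hd x hx).const_mul L).const_add δ
  -- The differential Grönwall inequality is applied to the right-hand side of `h`, which is
  -- differentiable, while `u` is only continuous.
  have key := le_gronwallBound_of_liminf_deriv_right_le
    (f := fun x => δ + L * ∫ τ in a..x, u τ) (f' := fun x => L * u x) (δ := δ) (K := L) (ε := 0)
    (a := a) (b := b) (fun x hx => (hd' x hx).continuousWithinAt)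
    (fun x hx r hr => by
      have h1 : HasDerivWithinAt (fun x => δ + L * ∫ τ in a..x, u τ) (L * u x) (Ici x) x :=
        (hd' x ⟨hx.1, hx.2.le⟩).mono_of_mem_nhdsWithin
          (mem_of_superset (Icc_mem_nhdsGE hx.2) (Icc_subset_Icc_left hx.1))
      have := h1.liminf_right_slope_le hr
      simpa [slope_def_field, div_eq_inv_mul] using this)
    (by simp) (fun x hx => by
      have := mul_le_mul_of_nonneg_left (h x ⟨hx.1, hx.2.le⟩) hL
      simpa using this) t ht
  rw [gronwallBound_ε0] at key
  exact (h t ht).trans key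

theorem IsSolution.apply_self {f : ℝ → E → E} {s : ℝ} {x : E} {φ : ℝ → E}
    (h : IsSolution f s x φ) : φ s = x := by
  simpa using (h s le_rfl).2

theorem IsSolution.intervalIntegrable {f : ℝ → E → E} {s : ℝ} {x : E} {φ : ℝ → E}
    (h : IsSolution f s x φ) {a b : ℝ} (ha : s ≤ a) (hb : s ≤ b) :
    IntervalIntegrable (fun τ => f τ (φ τ)) volume a b :=
  (h a ha).1.symm.trans (h b hb).1

theorem IsSolution.sub_eq_integral {f : ℝ → E → E} {s : ℝ} {x : E} {φ : ℝ → E}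
    (h : IsSolution f s x φ) {a b : ℝ} (ha : s ≤ a) (hb : s ≤ b) :
    φ b - φ a = ∫ τ in a..b, f τ (φ τ) := by
  rw [(h a ha).2, (h b hb).2, add_sub_add_left_eq_sub,
    intervalIntegral.integral_interval_sub_left (h b hb).1 (h a ha).1]

theorem IsSolution.restart {f : ℝ → E → E} {s : ℝ} {x : E} {φ : ℝ → E}
    (h : IsSolution f s x φ) {a : ℝ} (ha : s ≤ a) : IsSolution f a (φ a) φ := by
  intro t ht
  refine ⟨h.intervalIntegrable ha (ha.trans ht), ?_⟩
  rw [← h.sub_eq_integral ha (ha.trans ht)]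
  abel

theorem IsSolution.continuousOn {f : ℝ → E → E} {s : ℝ} {x : E} {φ : ℝ → E}
    (h : IsSolution f s x φ) (b : ℝ) : ContinuousOn φ (Icc s b) := by
  rcases lt_or_ge b s with hb | hb
  · simp [Icc_eq_empty_of_lt hb]
  have h1 : ContinuousOn (fun t => x + ∫ τ in s..t, f τ (φ τ)) (Icc s b) := by
    refine continuousOn_const.add ?_
    have := intervalIntegral.continuousOn_primitive_interval' (μ := volume) (a := s) (b₁ := s)
      (b₂ := b) (h b hb).1 left_mem_uIcc
    rwa [uIcc_of_le hb] at this
  exact h1.congr fun t ht => (h t ht.1).2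

/-- Two solutions in a region where the vector field is Lipschitz separate at most
exponentially. -/
theorem IsSolution.norm_sub_le {f : ℝ → E → E} {s b L : ℝ} {x y : E} {φ ψ : ℝ → E} {B : Set E}
    (hφ : IsSolution f s x φ) (hψ : IsSolution f s y ψ) (hL : 0 ≤ L)
    (hlip : ∀ t ∈ Icc s b, ∀ x ∈ B, ∀ y ∈ B, ‖f t x - f t y‖ ≤ L * ‖x - y‖)
    (hφB : ∀ t ∈ Icc s b, φ t ∈ B) (hψB : ∀ t ∈ Icc s b, ψ t ∈ B) :
    ∀ t ∈ Icc s b, ‖φ t - ψ t‖ ≤ ‖x - y‖ * Real.exp (L * (t - s)) := by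
  have hcont : ContinuousOn (fun t => ‖φ t - ψ t‖) (Icc s b) :=
    ((hφ.continuousOn b).sub (hψ.continuousOn b)).norm
  refine le_mul_exp_of_le_add_integral hL hcont fun t ht => ?_
  have h1 : φ t - ψ t = (x - y) + ∫ τ in s..t, (f τ (φ τ) - f τ (ψ τ)) := by
    rw [intervalIntegral.integral_sub (hφ t ht.1).1 (hψ t ht.1).1, (hφ t ht.1).2, (hψ t ht.1).2]
    abel
  rw [h1]
  refine (norm_add_le _ _).trans (add_le_add_right ?_ _)
  rw [← intervalIntegral.integral_const_mul]
  refine intervalIntegral.norm_integral_le_of_norm_le ht.1 (ae_of_all _ fun τ hτ => ?_)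
    (ContinuousOn.intervalIntegrable ?_)
  · have : τ ∈ Icc s b := ⟨hτ.1.le, hτ.2.trans ht.2⟩
    exact hlip τ this _ (hφB τ this) _ (hψB τ this)
  · rw [uIcc_of_le ht.1]
    exact continuousOn_const.mul (hcont.mono (Icc_subset_Icc_right ht.2))

/-- A solution that starts close enough to a solution in a ball stays in a slightly larger ball. -/
theorem IsSolution.mem_closedBall_of_close {f : ℝ → E → E} {s b L R : ℝ} {x y : E} {φ ψ : ℝ → E}
    (hφ : IsSolution f s x φ) (hψ : IsSolution f s y ψ) (hL : 0 ≤ L)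
    (hlip : ∀ t ∈ Icc s b, ∀ x ∈ Metric.closedBall (0 : E) (R + 1),
      ∀ y ∈ Metric.closedBall (0 : E) (R + 1), ‖f t x - f t y‖ ≤ L * ‖x - y‖)
    (hφR : ∀ t ∈ Icc s b, ‖φ t‖ ≤ R) (hxy : ‖x - y‖ * Real.exp (L * (b - s)) < 1) :
    ∀ t ∈ Icc s b, ‖ψ t‖ ≤ R + 1 := by
  have hcont : ContinuousOn (fun t => ‖φ t - ψ t‖) (Icc s b) :=
    ((hφ.continuousOn b).sub (hψ.continuousOn b)).norm
  suffices h : ∀ t ∈ Icc s b, ‖φ t - ψ t‖ < 1 by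
    intro t ht
    calc ‖ψ t‖ = ‖φ t - (φ t - ψ t)‖ := by rw [sub_sub_cancel]
      _ ≤ ‖φ t‖ + ‖φ t - ψ t‖ := _root_.norm_sub_le _ _
      _ ≤ R + 1 := add_le_add (hφR t ht) (h t ht).le
  by_contra! hne
  -- Exit-time argument: up to the first time `τ` at which the separation reaches `1`, both
  -- solutions lie in the larger ball, where the Lipschitz estimate keeps the separation below `1`
  -- at `τ` as well.
  set S := Icc s b ∩ (fun t => ‖φ t - ψ t‖) ⁻¹' Ici 1 with hS
  have hSc : IsCompact S :=
    isCompact_Icc.of_isClosed_subset (hcont.preimage_isClosed_of_isClosed isClosed_Icc isClosed_Ici)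
      inter_subset_left
  obtain ⟨t, ht, ht1⟩ := hne
  obtain ⟨τ, hτS, hτ⟩ := hSc.exists_isLeast ⟨t, ht, ht1⟩
  have hlt : ∀ r ∈ Ico s τ, ‖φ r - ψ r‖ < 1 := by
    intro r hr
    by_contra! hge
    exact absurd (hτ ⟨⟨hr.1, hr.2.le.trans hτS.1.2⟩, hge⟩) (not_le.2 hr.2)
  have hsτ : s < τ := by
    refine lt_of_le_of_ne hτS.1.1 fun he => ?_
    have h1 : (1 : ℝ) ≤ ‖x - y‖ := by
      have := hτS.2
      rw [← he, mem_preimage, hφ.apply_self, hψ.apply_self] at this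
      exact this
    have h2 : (1 : ℝ) ≤ Real.exp (L * (b - s)) :=
      Real.one_le_exp (mul_nonneg hL (sub_nonneg.2 (ht.1.trans ht.2)))
    nlinarith
  have hle : ∀ r ∈ Icc s τ, ‖φ r - ψ r‖ ≤ 1 := by
    have hcl : closure (Ico s τ) = Icc s τ := closure_Ico hsτ.ne
    intro r hr
    have hmem : r ∈ closure (Ico s τ) := hcl ▸ hr
    have hc : ContinuousOn (fun t => ‖φ t - ψ t‖) (closure (Ico s τ)) := by
      rw [hcl]; exact hcont.mono (Icc_subset_Icc_right hτS.1.2)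
    exact le_on_closure (fun r hr => (hlt r hr).le) hc continuousOn_const hmem
  have hsub : Icc s τ ⊆ Icc s b := Icc_subset_Icc_right hτS.1.2
  have key := hφ.norm_sub_le hψ hL (fun t ht => hlip t (hsub ht))
    (fun t ht => by
      rw [mem_closedBall_zero_iff]; linarith [hφR t (hsub ht)])
    (fun t ht => by
      rw [mem_closedBall_zero_iff]
      calc ‖ψ t‖ = ‖φ t - (φ t - ψ t)‖ := by rw [sub_sub_cancel]
        _ ≤ ‖φ t‖ + ‖φ t - ψ t‖ := _root_.norm_sub_le _ _
        _ ≤ R + 1 := add_le_add (hφR t (hsub ht)) (hle t ht)) τ (right_mem_Icc.2 hsτ.le)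
  have h3 : (1 : ℝ) ≤ ‖φ τ - ψ τ‖ := hτS.2
  have h4 : Real.exp (L * (τ - s)) ≤ Real.exp (L * (b - s)) :=
    Real.exp_le_exp.2 (mul_le_mul_of_nonneg_left (by linarith [hτS.1.2]) hL)
  nlinarith [norm_nonneg (x - y)]

theorem IsSolution.exists_norm_le {f : ℝ → E → E} {s : ℝ} {x : E} {φ : ℝ → E}
    (h : IsSolution f s x φ) (b : ℝ) : ∃ R, ∀ t ∈ Icc s b, ‖φ t‖ ≤ R := by
  obtain ⟨R, hR⟩ := isCompact_Icc.exists_bound_of_continuousOn (h.continuousOn b)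
  exact ⟨R, hR⟩

theorem IsSolution.unique [ProperSpace E] {t₀ : ℝ} {f : ℝ → E → E} (hf : RegularFrom t₀ f)
    {s : ℝ} (hs : t₀ ≤ s) {x : E} {φ ψ : ℝ → E}
    (hφ : IsSolution f s x φ) (hψ : IsSolution f s x ψ) {t : ℝ} (ht : s ≤ t) : φ t = ψ t := by
  obtain ⟨R₁, h₁⟩ := hφ.exists_norm_le t
  obtain ⟨R₂, h₂⟩ := hψ.exists_norm_le t
  obtain ⟨L, hL, hlip⟩ := hf.exists_lipschitz t (max R₁ R₂)
  have := hφ.norm_sub_le hψ hL (fun τ hτ => hlip τ ⟨hs.trans hτ.1, hτ.2⟩)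
    (fun τ hτ => mem_closedBall_zero_iff.2 ((h₁ τ hτ).trans (le_max_left _ _)))
    (fun τ hτ => mem_closedBall_zero_iff.2 ((h₂ τ hτ).trans (le_max_right _ _))) t
    (right_mem_Icc.2 ht)
  rw [sub_self, norm_zero, zero_mul] at this
  exact sub_eq_zero.1 (norm_le_zero_iff.1 this)

theorem ForwardComplete.isSolution_flow {t₀ : ℝ} {f : ℝ → E → E} (hfc : ForwardComplete t₀ f)
    {s : ℝ} (hs : t₀ ≤ s) (x : E) : IsSolution f s x (fun t => flow f t s x) := by
  have h := hfc s hs x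
  simp only [flow, dif_pos h]
  exact h.choose_spec

theorem ForwardComplete.flow_flow [ProperSpace E] {t₀ : ℝ} {f : ℝ → E → E}
    (hfc : ForwardComplete t₀ f) (hf : RegularFrom t₀ f) {s t₁ t : ℝ} (hs : t₀ ≤ s)
    (h₁ : s ≤ t₁) (ht : t₁ ≤ t) (x : E) :
    flow f t t₁ (flow f t₁ s x) = flow f t s x :=
  (hfc.isSolution_flow (hs.trans h₁) _).unique hf (hs.trans h₁)
    ((hfc.isSolution_flow hs x).restart h₁) ht

/-- Trajectories that start in a compact set stay in a bounded set for a bounded time. -/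
theorem ForwardComplete.exists_norm_flow_le [ProperSpace E] {t₀ : ℝ} {f : ℝ → E → E}
    (hfc : ForwardComplete t₀ f) (hf : RegularFrom t₀ f) {s : ℝ} (hs : t₀ ≤ s) (b : ℝ)
    {C : Set E} (hC : IsCompact C) :
    ∃ R, ∀ x ∈ C, ∀ t ∈ Icc s b, ‖flow f t s x‖ ≤ R := by
  -- By compactness it suffices to bound the trajectories from a neighbourhood of each point.
  refine hC.induction_on (p := fun C => ∃ R, ∀ x ∈ C, ∀ t ∈ Icc s b, ‖flow f t s x‖ ≤ R)
    ⟨0, by simp⟩ ?_ ?_ ?_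
  · rintro A B hAB ⟨R, hR⟩
    exact ⟨R, fun x hx => hR x (hAB hx)⟩
  · rintro A B ⟨R₁, h₁⟩ ⟨R₂, h₂⟩
    refine ⟨max R₁ R₂, fun x hx t ht => hx.elim (fun hx => ?_) fun hx => ?_⟩
    · exact (h₁ x hx t ht).trans (le_max_left _ _)
    · exact (h₂ x hx t ht).trans (le_max_right _ _)
  · intro x _
    have hx := hfc.isSolution_flow hs x
    obtain ⟨R, hR⟩ := hx.exists_norm_le b
    obtain ⟨L, hL, hlip⟩ := hf.exists_lipschitz b (R + 1)
    refine ⟨{y | ‖x - y‖ * Real.exp (L * (b - s)) < 1}, ?_, R + 1, fun y hy =>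
      hx.mem_closedBall_of_close (hfc.isSolution_flow hs y) hL
        (fun τ hτ => hlip τ ⟨hs.trans hτ.1, hτ.2⟩) hR hy⟩
    refine mem_nhdsWithin_of_mem_nhds (IsOpen.mem_nhds ?_ (by simp))
    exact isOpen_lt (by fun_prop) continuous_const

/-- The flow over a bounded time is Lipschitz in the initial state, uniformly on compact sets. -/
theorem ForwardComplete.exists_flow_lipschitz [ProperSpace E] {t₀ : ℝ} {f : ℝ → E → E}
    (hfc : ForwardComplete t₀ f) (hf : RegularFrom t₀ f) {s : ℝ} (hs : t₀ ≤ s) (b : ℝ)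
    {C : Set E} (hC : IsCompact C) :
    ∃ M, 0 ≤ M ∧ ∀ x ∈ C, ∀ y ∈ C, ∀ t ∈ Icc s b,
      ‖flow f t s x - flow f t s y‖ ≤ M * ‖x - y‖ := by
  obtain ⟨R, hR⟩ := hfc.exists_norm_flow_le hf hs b hC
  obtain ⟨L, hL, hlip⟩ := hf.exists_lipschitz b R
  refine ⟨Real.exp (L * (b - s)), (Real.exp_pos _).le, fun x hx y hy t ht => ?_⟩
  have := (hfc.isSolution_flow hs x).norm_sub_le (hfc.isSolution_flow hs y) hL
    (fun τ hτ => hlip τ ⟨hs.trans hτ.1, hτ.2⟩)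
    (fun τ hτ => mem_closedBall_zero_iff.2 (hR x hx τ hτ))
    (fun τ hτ => mem_closedBall_zero_iff.2 (hR y hy τ hτ)) t ht
  rw [mul_comm] at this
  refine this.trans (mul_le_mul_of_nonneg_right (Real.exp_le_exp.2 ?_) (norm_nonneg _))
  exact mul_le_mul_of_nonneg_left (by linarith [ht.2]) hL

end Systems

/-! ### Logarithmic norms and weighted norms along perturbed linear equations. -/

section Systems

variable {E : Type*} [NormedAddCommGroup E] [NormedSpace ℝ E]

/-- The one-sided derivative at `0` of `s ↦ N (z + s • A z)` is at most `c * N z` for every `z`,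
that is, the logarithmic norm of `A` with respect to `N` is at most `c`. -/
def LogNormLE (N : Seminorm ℝ E) (A : E →L[ℝ] E) (c : ℝ) : Prop :=
  ∀ z : E, ∀ ε : ℝ, 0 < ε → ∀ᶠ s : ℝ in 𝓝[>] 0, N (z + s • A z) ≤ (1 + s * c) * N z + s * ε

/-- A bound of the logarithmic norm bounds the derivative of the norm along solutions of a
perturbed linear equation. -/
theorem LogNormLE.deriv_le {N : Seminorm ℝ E} (hN : Continuous N) {A : E →L[ℝ] E} {c : ℝ}
    (hA : LogNormLE N A c) {z : ℝ → E} {t u' : ℝ} {r : E} (hz : HasDerivAt z (A (z t) + r) t)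
    (hu : HasDerivAt (fun τ => N (z τ)) u' t) : u' ≤ c * N (z t) + N r := by
  refine le_of_forall_pos_le_add fun ε hε => ?_
  refine le_of_tendsto hu.tendsto_slope_zero_right ?_
  have h1 : Tendsto (fun s : ℝ => N (s⁻¹ • (z (t + s) - z t) - (A (z t) + r))) (𝓝[>] 0) (𝓝 0) := by
    have := (hN.tendsto _).comp (hz.tendsto_slope_zero_right.sub_const (A (z t) + r))
    simpa [Function.comp_def] using this
  filter_upwards [h1.eventually_lt_const (half_pos hε), hA (z t) (ε / 2) (half_pos hε),
    self_mem_nhdsWithin] with s hs1 hs2 hs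
  have hs : 0 < s := hs
  -- `q` is the error of the difference quotient; it tends to `0` in `N`.
  set q := s⁻¹ • (z (t + s) - z t) - (A (z t) + r) with hq
  have h2 : z (t + s) = (z t + s • A (z t)) + (s • r + s • q) := by
    rw [hq, smul_sub, smul_add, smul_inv_smul₀ hs.ne']
    abel
  have h3 : N (z (t + s)) ≤ (1 + s * c) * N (z t) + s * (ε / 2) + (s * N r + s * (ε / 2)) := by
    rw [h2]
    refine (map_add_le_add N _ _).trans (add_le_add hs2 ((map_add_le_add N _ _).trans ?_))
    rw [map_smul_eq_mul, map_smul_eq_mul, Real.norm_of_nonneg hs.le]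
    gcongr
  rw [smul_eq_mul, inv_mul_le_iff₀ hs]
  linarith

/-- The reverse triangle inequality passes the Lipschitz bound from `z` to `N ∘ z`. Although `N`
need not be differentiable, this gives an almost everywhere derivative and the fundamental theorem
of calculus. -/
theorem absolutelyContinuous_seminorm {N : Seminorm ℝ E}
    {C : ℝ} (hC : 0 ≤ C) (hN : ∀ x, N x ≤ C * ‖x‖) {z : ℝ → E} {a b K : ℝ} (hab : a ≤ b)
    (hz : ∀ t ∈ Icc a b, ∀ τ ∈ Icc a b, ‖z t - z τ‖ ≤ K * |t - τ|) :
    AbsolutelyContinuousOnInterval (fun t => N (z t)) a b := by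
  refine LipschitzOnWith.absolutelyContinuousOnInterval (K := Real.toNNReal (C * K)) ?_
  rw [uIcc_of_le hab]
  refine LipschitzOnWith.of_dist_le_mul fun t ht τ hτ => ?_
  rw [Real.dist_eq, Real.dist_eq]
  calc |N (z t) - N (z τ)| ≤ N (z t - z τ) := abs_sub_map_le_sub N _ _
    _ ≤ C * ‖z t - z τ‖ := hN _
    _ ≤ C * (K * |t - τ|) := mul_le_mul_of_nonneg_left (hz t ht τ hτ) hC
    _ = C * K * |t - τ| := by ring
    _ ≤ Real.toNNReal (C * K) * |t - τ| :=
      mul_le_mul_of_nonneg_right (Real.le_coe_toNNReal _) (abs_nonneg _)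

theorem absolutelyContinuous_exp (c d a b : ℝ) :
    AbsolutelyContinuousOnInterval (fun t => Real.exp (-(c * (t - d)))) a b := by
  have h : ContDiff ℝ 1 fun t : ℝ => Real.exp (-(c * (t - d))) := by fun_prop
  exact h.contDiffOn.absolutelyContinuousOnInterval

theorem absolutelyContinuous_exp_mul_seminorm {N : Seminorm ℝ E}
    {C : ℝ} (hC : 0 ≤ C) (hN : ∀ x, N x ≤ C * ‖x‖) {z : ℝ → E} {a b K : ℝ} (hab : a ≤ b)
    (hz : ∀ t ∈ Icc a b, ∀ τ ∈ Icc a b, ‖z t - z τ‖ ≤ K * |t - τ|) (c : ℝ) :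
    AbsolutelyContinuousOnInterval (fun t => Real.exp (-(c * (t - a))) * N (z t)) a b :=
  (absolutelyContinuous_exp c a a b).fun_mul (absolutelyContinuous_seminorm hC hN hab hz)

/-- The fundamental theorem of calculus for absolutely continuous functions. Only upper bounds of
the derivative are available later; its positive part is also bounded below, so it can be squeezed
to `0`. -/
theorem exp_mul_seminorm_le_add_integral {N : Seminorm ℝ E}
    {C : ℝ} (hC : 0 ≤ C) (hN : ∀ x, N x ≤ C * ‖x‖) {z : ℝ → E} {a b K : ℝ} (hab : a ≤ b)
    (hz : ∀ t ∈ Icc a b, ∀ τ ∈ Icc a b, ‖z t - z τ‖ ≤ K * |t - τ|) (c : ℝ) :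
    Real.exp (-(c * (b - a))) * N (z b) ≤ N (z a) +
      ∫ t in a..b, max (deriv (fun t => Real.exp (-(c * (t - a))) * N (z t)) t) 0 := by
  have hac := absolutelyContinuous_exp_mul_seminorm hC hN hab hz c
  have h1 := hac.integral_deriv_eq_sub
  have h2 := intervalIntegral.integral_mono hab hac.intervalIntegrable_deriv
    (g := fun t => max (deriv (fun t => Real.exp (-(c * (t - a))) * N (z t)) t) 0)
    ((intervalIntegrable_iff.2 ((intervalIntegrable_iff.1
      hac.intervalIntegrable_deriv).pos_part)))
    (fun t => le_max_left _ _)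
  rw [h1] at h2
  simp only [sub_self, mul_zero, neg_zero, Real.exp_zero, one_mul] at h2
  linarith

/-- Almost everywhere the exponentially weighted norm of a solution of a perturbed linear equation
grows at most as fast as the norm of the perturbation. -/
theorem ae_deriv_exp_mul_seminorm_le {N : Seminorm ℝ E} (hNc : Continuous N)
    {C : ℝ} (hC : 0 ≤ C) (hN : ∀ x, N x ≤ C * ‖x‖) {z : ℝ → E} {a b K : ℝ} (hab : a ≤ b)
    (hz : ∀ t ∈ Icc a b, ∀ τ ∈ Icc a b, ‖z t - z τ‖ ≤ K * |t - τ|) {c : ℝ} (hc : 0 ≤ c)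
    {A : ℝ → E →L[ℝ] E} {r : ℝ → E} (hA : ∀ t ∈ Icc a b, LogNormLE N (A t) c)
    (hd : ∀ᵐ t, t ∈ Icc a b → HasDerivAt z (A t (z t) + r t) t) :
    ∀ᵐ t, t ∈ Icc a b →
      deriv (fun t => Real.exp (-(c * (t - a))) * N (z t)) t ≤ N (r t) := by
  have hu := (absolutelyContinuous_seminorm hC hN hab hz).ae_differentiableAt
  rw [uIcc_of_le hab] at hu
  filter_upwards [hu, hd] with t hu hd ht
  have h1 := (hA t ht).deriv_le hNc (hd ht) (hu ht).hasDerivAt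
  have h2 : HasDerivAt (fun t => Real.exp (-(c * (t - a))))
      (Real.exp (-(c * (t - a))) * (-(c * 1))) t :=
    ((((hasDerivAt_id t).sub_const a).const_mul c).neg).exp
  rw [(h2.fun_mul (hu ht).hasDerivAt).deriv]
  -- Here `0 ≤ c` enters: the weight can be dropped in front of the perturbation.
  have h3 : Real.exp (-(c * (t - a))) ≤ 1 :=
    Real.exp_le_one_iff.2 (neg_nonpos.2 (mul_nonneg hc (sub_nonneg.2 ht.1)))
  have h4 := Real.exp_pos (-(c * (t - a)))
  have h5 : 0 ≤ N (r t) := apply_nonneg N _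
  set e := Real.exp (-(c * (t - a)))
  set u' := deriv (fun t => N (z t)) t
  calc e * (-(c * 1)) * N (z t) + e * u' = e * (u' - c * N (z t)) := by ring
    _ ≤ e * N (r t) := mul_le_mul_of_nonneg_left (by linarith) h4.le
    _ ≤ 1 * N (r t) := mul_le_mul_of_nonneg_right h3 h5
    _ = N (r t) := one_mul _

end Systems

/-! ### Exponential separation of neighbouring trajectories. -/

section Systems

variable {E : Type*} [NormedAddCommGroup E] [NormedSpace ℝ E]

/-- Growth of a family of solutions of a linear equation with perturbations that are negligible
with respect to the size `h k` of the solutions. -/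
theorem eventually_seminorm_le_of_negligible_perturbation {N : Seminorm ℝ E} (hNc : Continuous N)
    {C : ℝ} (hC : 0 ≤ C) (hN : ∀ x, N x ≤ C * ‖x‖) {a b : ℝ} (hab : a ≤ b) {c : ℝ} (hc : 0 ≤ c)
    {A : ℝ → E →L[ℝ] E} (hA : ∀ t ∈ Icc a b, LogNormLE N (A t) c)
    {z r : ℕ → ℝ → E} {h : ℕ → ℝ} (hh : ∀ k, 0 < h k) {K : ℕ → ℝ}
    (hz : ∀ k, ∀ t ∈ Icc a b, ∀ τ ∈ Icc a b, ‖z k t - z k τ‖ ≤ K k * |t - τ|)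
    (hd : ∀ k, ∀ᵐ t, t ∈ Icc a b → HasDerivAt (z k) (A t (z k t) + r k t) t)
    {D : ℝ} (hD : ∀ k, ∀ t ∈ Icc a b, ‖r k t‖ ≤ D * h k)
    (hr : ∀ t ∈ Icc a b, Tendsto (fun k => (h k)⁻¹ * ‖r k t‖) atTop (𝓝 0))
    {B : ℝ} (hB : ∀ k, N (z k a) ≤ B * h k) {ε : ℝ} (hε : 0 < ε) :
    ∀ᶠ k in atTop, N (z k b) ≤ Real.exp (c * (b - a)) * (B + ε) * h k := by
  set G : ℕ → ℝ → ℝ := fun k t => Real.exp (-(c * (t - a))) * N (z k t) with hG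
  -- Rescaled by `h k`, the growth in excess of the rate `c` is dominated by `C * D` and tends to
  -- `0` pointwise almost everywhere, hence in integral.
  set ρ : ℕ → ℝ → ℝ := fun k t => (h k)⁻¹ * max (deriv (G k) t) 0 with hρ
  have hderiv : ∀ᵐ t, ∀ k, t ∈ Icc a b → deriv (G k) t ≤ N (r k t) :=
    ae_all_iff.2 fun k => ae_deriv_exp_mul_seminorm_le hNc hC hN hab (hz k) hc hA (hd k)
  have hρle : ∀ᵐ t, ∀ k, t ∈ Icc a b → ρ k t ≤ C * ((h k)⁻¹ * ‖r k t‖) := by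
    filter_upwards [hderiv] with t ht k htab
    have h1 : max (deriv (G k) t) 0 ≤ C * ‖r k t‖ :=
      max_le ((ht k htab).trans (hN _)) (by positivity)
    calc ρ k t ≤ (h k)⁻¹ * (C * ‖r k t‖) :=
          mul_le_mul_of_nonneg_left h1 (inv_nonneg.2 (hh k).le)
      _ = C * ((h k)⁻¹ * ‖r k t‖) := by ring
  have hρ0 : ∀ k t, 0 ≤ ρ k t := fun k t =>
    mul_nonneg (inv_nonneg.2 (hh k).le) (le_max_right _ _)
  have hlim : Tendsto (fun k => ∫ t in a..b, ρ k t) atTop (𝓝 (∫ _ in a..b, (0 : ℝ))) := by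
    refine intervalIntegral.tendsto_integral_filter_of_dominated_convergence (fun _ => C * D)
      ?_ ?_ intervalIntegrable_const ?_
    · exact Eventually.of_forall fun k =>
        (((measurable_deriv (G k)).max measurable_const).const_mul _).aestronglyMeasurable
    · refine Eventually.of_forall fun k => ?_
      filter_upwards [hρle] with t ht htab
      rw [uIoc_of_le hab] at htab
      have htab := Ioc_subset_Icc_self htab
      rw [Real.norm_of_nonneg (hρ0 k t)]
      refine (ht k htab).trans (mul_le_mul_of_nonneg_left ?_ hC)
      rw [inv_mul_le_iff₀ (hh k), mul_comm]
      exact hD k t htab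
    · filter_upwards [hρle] with t ht htab
      rw [uIoc_of_le hab] at htab
      have htab := Ioc_subset_Icc_self htab
      have h1 := (hr t htab).const_mul C
      rw [mul_zero] at h1
      exact squeeze_zero (fun k => hρ0 k t) (fun k => ht k htab) h1
  rw [intervalIntegral.integral_zero] at hlim
  filter_upwards [hlim.eventually_lt_const hε] with k hk
  have h1 := exp_mul_seminorm_le_add_integral hC hN hab (hz k) c
  have h2 : ∫ t in a..b, max (deriv (G k) t) 0 = h k * ∫ t in a..b, ρ k t := by
    rw [← intervalIntegral.integral_const_mul]
    refine intervalIntegral.integral_congr fun t _ => ?_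
    simp only [hρ]
    rw [mul_inv_cancel_left₀ (hh k).ne']
  rw [h2] at h1
  have h3 : h k * ∫ t in a..b, ρ k t ≤ h k * ε := mul_le_mul_of_nonneg_left hk.le (hh k).le
  have h4 : Real.exp (-(c * (b - a))) * N (z k b) ≤ (B + ε) * h k := by
    linarith [hB k]
  calc N (z k b) = Real.exp (c * (b - a)) * (Real.exp (-(c * (b - a))) * N (z k b)) := by
        rw [← mul_assoc, ← Real.exp_add, add_neg_cancel, Real.exp_zero, one_mul]
    _ ≤ Real.exp (c * (b - a)) * ((B + ε) * h k) :=
        mul_le_mul_of_nonneg_left h4 (Real.exp_pos _).le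
    _ = _ := by ring

/-- The separation of neighbouring solutions, to first order, from a bound of the logarithmic norm
of the Jacobian along one solution. -/
theorem eventually_seminorm_flow_sub_le [ProperSpace E] {t₀ : ℝ} {f : ℝ → E → E}
    (hf : RegularFrom t₀ f) (hfc : ForwardComplete t₀ f) {N : Seminorm ℝ E} (hNc : Continuous N)
    {C : ℝ} (hC : 0 ≤ C) (hN : ∀ x, N x ≤ C * ‖x‖) {s a b : ℝ} (hs : t₀ ≤ s) (hsa : s ≤ a)
    (hab : a ≤ b) {c : ℝ} (hc : 0 ≤ c) {S : Set E} (hS : IsCompact S) {v : E} (hv : v ∈ S)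
    (hlog : ∀ t ∈ Icc a b, LogNormLE N (fderiv ℝ (f t) (flow f t s v)) c)
    {d : E} {h : ℕ → ℝ} (hh : ∀ k, 0 < h k) (hh0 : Tendsto h atTop (𝓝 0))
    (hvS : ∀ k, v + h k • d ∈ S) {M : ℝ}
    (hM : ∀ k, ‖flow f a s (v + h k • d) - flow f a s v‖ ≤ M * (h k * ‖d‖)) {ε : ℝ} (hε : 0 < ε) :
    ∀ᶠ k in atTop, N (flow f b s (v + h k • d) - flow f b s v) ≤
      Real.exp (c * (b - a)) * (C * M * ‖d‖ + ε) * h k := by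
  obtain ⟨R, hR⟩ := hfc.exists_norm_flow_le hf hs b hS
  obtain ⟨L, hL, hlip⟩ := hf.exists_lipschitz b R
  obtain ⟨M', hM', hflow⟩ := hfc.exists_flow_lipschitz hf hs b hS
  have hsub : Icc a b ⊆ Icc s b := Icc_subset_Icc_left hsa
  have hsol : ∀ x, IsSolution f s x (fun t => flow f t s x) := hfc.isSolution_flow hs
  set z : ℕ → ℝ → E := fun k t => flow f t s (v + h k • d) - flow f t s v with hzdef
  set A : ℝ → E →L[ℝ] E := fun t => fderiv ℝ (f t) (flow f t s v) with hAdef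
  -- The first-order Taylor remainder of `f t` at the base trajectory, so that `z k` solves `z' = A
  -- z + r` almost everywhere.
  set r : ℕ → ℝ → E := fun k t =>
    f t (flow f t s (v + h k • d)) - f t (flow f t s v) - A t (z k t) with hrdef
  have hzle : ∀ k, ∀ t ∈ Icc s b, ‖z k t‖ ≤ M' * ‖d‖ * h k := by
    intro k t ht
    have := hflow _ (hvS k) _ hv t ht
    rw [add_sub_cancel_left, norm_smul, Real.norm_of_nonneg (hh k).le] at this
    linarith
  have hfle : ∀ k, ∀ t ∈ Icc s b,
      ‖f t (flow f t s (v + h k • d)) - f t (flow f t s v)‖ ≤ L * (M' * ‖d‖ * h k) := by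
    intro k t ht
    refine (hlip t ⟨hs.trans ht.1, ht.2⟩ _ (mem_closedBall_zero_iff.2 (hR _ (hvS k) t ht)) _
      (mem_closedBall_zero_iff.2 (hR _ hv t ht))).trans ?_
    exact mul_le_mul_of_nonneg_left (hzle k t ht) hL
  have hfd : ∀ t ∈ Icc s b, HasFDerivAt (f t) (A t) (flow f t s v) := fun t ht =>
    ((hf.contDiff t (hs.trans ht.1)).differentiable one_ne_zero).differentiableAt.hasFDerivAt
  obtain ⟨L', hL'⟩ := hf.jacobian_bounded b (Metric.closedBall (0 : E) R)
    (isCompact_closedBall 0 R)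
  refine eventually_seminorm_le_of_negligible_perturbation hNc hC hN hab hc (A := A) hlog
    (z := z) (r := r) hh (K := fun k => L * (M' * ‖d‖ * h k))
    (D := L * (M' * ‖d‖) + |L'| * (M' * ‖d‖)) ?_ ?_ ?_ ?_ ?_ hε
  · intro k t ht τ hτ
    have h1 : z k t - z k τ = ∫ x in τ..t,
        (f x (flow f x s (v + h k • d)) - f x (flow f x s v)) := by
      rw [intervalIntegral.integral_sub
          ((hsol _).intervalIntegrable (hsa.trans hτ.1) (hsa.trans ht.1))
          ((hsol _).intervalIntegrable (hsa.trans hτ.1) (hsa.trans ht.1)),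
        ← (hsol _).sub_eq_integral (hsa.trans hτ.1) (hsa.trans ht.1),
        ← (hsol _).sub_eq_integral (hsa.trans hτ.1) (hsa.trans ht.1)]
      simp only [hzdef]
      abel
    rw [h1]
    refine intervalIntegral.norm_integral_le_of_norm_le_const fun x hx => hfle k x (hsub ?_)
    exact (ordConnected_Icc.uIcc_subset hτ ht) (uIoc_subset_uIcc hx)
  · intro k
    have hD : ∀ x, ∀ᵐ t, t ∈ Icc a b → HasDerivAt (fun t => flow f t s x)
        (f t (flow f t s x)) t := by
      intro x
      have h1 := ((hsol x).intervalIntegrable le_rfl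
        (hsa.trans hab)).ae_hasDerivAt_integral
      -- The integral equation holds only on `[s, ∞)`, so no two-sided derivative is available at
      -- `s`.
      have h2 : ∀ᵐ t : ℝ, t ≠ s := by simp [ae_iff, measure_singleton]
      rw [uIcc_of_le (hsa.trans hab)] at h1
      filter_upwards [h1, h2] with t ht hts htab
      have h3 := (ht (hsub htab) s (left_mem_Icc.2 (hsa.trans hab))).const_add x
      refine h3.congr_of_eventuallyEq ?_
      filter_upwards [lt_mem_nhds (lt_of_le_of_ne (hsub htab).1 hts.symm)] with τ hτ
      exact ((hsol x) τ hτ.le).2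
    filter_upwards [hD (v + h k • d), hD v] with t h1 h2 ht
    refine ((h1 ht).fun_sub (h2 ht)).congr_deriv ?_
    simp only [hrdef]
    abel
  · intro k t ht
    have ht' := hsub ht
    have h1 : ‖A t (z k t)‖ ≤ |L'| * (M' * ‖d‖ * h k) :=
      ((A t).le_opNorm _).trans (mul_le_mul ((hL' t ⟨hs.trans ht'.1, ht'.2⟩ _
        (mem_closedBall_zero_iff.2 (hR _ hv t ht'))).trans (le_abs_self _)) (hzle k t ht')
        (norm_nonneg _) (abs_nonneg _))
    refine (norm_sub_le _ _).trans ((add_le_add (hfle k t ht') h1).trans (le_of_eq ?_))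
    ring
  · intro t ht
    have ht' := hsub ht
    have hz0 : Tendsto (fun k => z k t) atTop (𝓝 0) := by
      refine squeeze_zero_norm (fun k => hzle k t ht') ?_
      simpa using hh0.const_mul (M' * ‖d‖)
    have ho := (hasFDerivAt_iff_isLittleO_nhds_zero.1 (hfd t ht')).comp_tendsto hz0
    have hO : (fun k => z k t) =O[atTop] h :=
      Asymptotics.IsBigO.of_bound (M' * ‖d‖) (Eventually.of_forall fun k => by
        rw [Real.norm_of_nonneg (hh k).le]; exact hzle k t ht')
    have ho' : (fun k => r k t) =o[atTop] h := by
      refine (ho.trans_isBigO hO).congr_left fun k => ?_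
      simp only [Function.comp_apply, hrdef, hzdef, add_sub_cancel]
    have := ho'.norm_left.tendsto_div_nhds_zero
    simpa [div_eq_inv_mul] using this
  · intro k
    refine (hN _).trans ?_
    calc C * ‖z k a‖ ≤ C * (M * (h k * ‖d‖)) := mul_le_mul_of_nonneg_left (hM k) hC
      _ = C * M * ‖d‖ * h k := by ring

/-- If the logarithmic norm of the Jacobian is bounded by `c` along all solutions from a convex set,
for large times, then solutions from that set separate at most at the exponential rate `c`. -/
theorem exists_norm_flow_sub_le_mul_exp [ProperSpace E] {t₀ : ℝ} {f : ℝ → E → E}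
    (hf : RegularFrom t₀ f) (hfc : ForwardComplete t₀ f) {N : Seminorm ℝ E} (hNc : Continuous N)
    {C C' : ℝ} (hC : 0 ≤ C) (hN : ∀ x, N x ≤ C * ‖x‖) (hC' : 0 ≤ C') (hN' : ∀ x, ‖x‖ ≤ C' * N x)
    {s a : ℝ} (hs : t₀ ≤ s) (hsa : s ≤ a) {c : ℝ} (hc : 0 ≤ c) {S S' : Set E}
    (hS : Convex ℝ S) (hSS' : S ⊆ S') (hS' : IsCompact S')
    (hlog : ∀ t, a ≤ t → ∀ v ∈ S, LogNormLE N (fderiv ℝ (f t) (flow f t s v)) c) :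
    ∃ M, 0 ≤ M ∧ ∀ t, a ≤ t → ∀ v ∈ S, ∀ w ∈ S,
      ‖flow f t s v - flow f t s w‖ ≤ M * Real.exp (c * (t - a)) * ‖v - w‖ := by
  obtain ⟨M, hM, hflow⟩ := hfc.exists_flow_lipschitz hf hs a hS'
  refine ⟨C' * (C * M), by positivity, fun t ht v hv w hw => ?_⟩
  -- `M'` depends on `t` and serves only the continuity of `F`; the final constant uses `M`, the
  -- Lipschitz constant up to time `a`.
  obtain ⟨M', hM', hflow'⟩ := hfc.exists_flow_lipschitz hf hs t hS'
  set d := v - w with hd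
  have hmem : ∀ σ ∈ Icc (0 : ℝ) 1, w + σ • d ∈ S := by
    intro σ hσ
    have := hS.add_smul_sub_mem hw hv hσ
    exact this
  have htmem : t ∈ Icc s t := right_mem_Icc.2 (hsa.trans ht)
  set F : ℝ → ℝ := fun σ => ‖flow f t s (w + σ • d) - flow f t s w‖ with hF
  have hFsub : ∀ σ τ, F τ - F σ ≤ ‖flow f t s (w + τ • d) - flow f t s (w + σ • d)‖ := by
    intro σ τ
    refine (norm_sub_norm_le _ _).trans (le_of_eq ?_)
    rw [sub_sub_sub_cancel_right]
  have hFc : ContinuousOn F (Icc 0 1) := by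
    have h1 : LipschitzOnWith (Real.toNNReal (M' * ‖d‖)) (fun σ : ℝ => flow f t s (w + σ • d))
        (Icc 0 1) := by
      refine LipschitzOnWith.of_dist_le_mul fun σ hσ τ hτ => ?_
      rw [dist_eq_norm, Real.dist_eq, Real.coe_toNNReal _ (by positivity)]
      refine (hflow' _ (hSS' (hmem σ hσ)) _ (hSS' (hmem τ hτ)) t htmem).trans (le_of_eq ?_)
      rw [add_sub_add_left_eq_sub, ← sub_smul, norm_smul, Real.norm_eq_abs]
      ring
    exact (h1.continuousOn.sub continuousOn_const).norm
  set B := C' * (C * M) * Real.exp (c * (t - a)) * ‖d‖ with hB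
  -- A mean value inequality along the segment from `w` to `v`. It asks for small right slopes only
  -- frequently, so one sequence of increments suffices.
  have key := image_le_of_liminf_slope_right_le_deriv_boundary (f := F) (a := 0) (b := 1)
    (B := fun σ => B * σ) (B' := fun _ => B) hFc (by simp [hF]) (by fun_prop)
    (fun x _ => by simpa using ((hasDerivAt_id x).const_mul B).hasDerivWithinAt) ?_
    (right_mem_Icc.2 zero_le_one)
  · simpa [hF, hd] using key
  intro σ hσ ρ hρ
  -- The factor `1 - σ` keeps `σ + h k ≤ 1`, so the shifted points stay on the segment.
  set h : ℕ → ℝ := fun k => (1 - σ) * (1 / ((k : ℝ) + 1)) with hh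
  have hpos : ∀ k, 0 < h k := fun k =>
    mul_pos (sub_pos.2 hσ.2) (by positivity)
  have hlim : Tendsto h atTop (𝓝 0) := by
    simpa [hh] using (tendsto_one_div_add_atTop_nhds_zero_nat (𝕜 := ℝ)).const_mul (1 - σ)
  have hle : ∀ k, σ + h k ≤ 1 := by
    intro k
    have h1 : 1 / ((k : ℝ) + 1) ≤ 1 := by
      rw [div_le_one (by positivity)]; linarith [(Nat.cast_nonneg k : (0 : ℝ) ≤ k)]
    have := mul_le_mul_of_nonneg_left h1 (sub_nonneg.2 hσ.2.le)
    simp only [hh]; linarith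
  have hmem' : ∀ k, w + σ • d + h k • d ∈ S := by
    intro k
    rw [add_assoc, ← add_smul]
    exact hmem _ ⟨add_nonneg hσ.1 (hpos k).le, hle k⟩
  have hσm := hmem σ ⟨hσ.1, hσ.2.le⟩
  set e := C' * Real.exp (c * (t - a)) with he
  have he0 : 0 ≤ e := by positivity
  obtain ⟨ε, hε, hεB⟩ : ∃ ε > 0, B + e * ε < ρ := by
    refine ⟨(ρ - B) / (2 * (e + 1)), div_pos (sub_pos.2 hρ) (by positivity), ?_⟩
    have h1 : e * ((ρ - B) / (2 * (e + 1))) ≤ (ρ - B) / 2 := by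
      rw [mul_div_assoc', div_le_div_iff₀ (by positivity) two_pos]
      nlinarith [sub_pos.2 hρ]
    linarith
  have hev := eventually_seminorm_flow_sub_le hf hfc hNc hC hN hs hsa ht hc hS' (hSS' hσm)
    (fun τ hτ => hlog τ hτ.1 _ hσm) hpos hlim (fun k => hSS' (hmem' k)) (M := M)
    (fun k => by
      refine (hflow _ (hSS' (hmem' k)) _ (hSS' hσm) a (right_mem_Icc.2 hsa)).trans (le_of_eq ?_)
      rw [add_sub_cancel_left, norm_smul, Real.norm_of_nonneg (hpos k).le]) hε
  have htend : Tendsto (fun k => σ + h k) atTop (𝓝[>] σ) := by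
    refine tendsto_nhdsWithin_iff.2 ⟨by simpa using hlim.const_add σ, ?_⟩
    exact Eventually.of_forall fun k => lt_add_of_pos_right σ (hpos k)
  refine htend.frequently (Eventually.frequently ?_)
  filter_upwards [hev] with k hk
  rw [slope_def_field, add_sub_cancel_left, div_lt_iff₀ (hpos k)]
  have h1 := hFsub σ (σ + h k)
  rw [add_smul, ← add_assoc] at h1
  calc F (σ + h k) - F σ
      ≤ C' * N (flow f t s (w + σ • d + h k • d) - flow f t s (w + σ • d)) := h1.trans (hN' _)
    _ ≤ C' * (Real.exp (c * (t - a)) * (C * M * ‖d‖ + ε) * h k) :=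
        mul_le_mul_of_nonneg_left hk hC'
    _ = (B + e * ε) * h k := by rw [hB, he]; ring
    _ < ρ * h k := mul_lt_mul_of_pos_right hεB (hpos k)

end Systems

/-! ### Seminorms in finite dimension. -/

section FiniteDimension

variable {V : Type*} [NormedAddCommGroup V] [NormedSpace ℝ V] [FiniteDimensional ℝ V]

/-- A finite convex function on a finite-dimensional space is locally Lipschitz. -/
theorem continuous_seminorm (p : Seminorm ℝ V) : Continuous p :=
  p.convexOn.locallyLipschitz.continuous

theorem exists_seminorm_le (p : Seminorm ℝ V) : ∃ C, 0 ≤ C ∧ ∀ x, p x ≤ C * ‖x‖ := by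
  obtain ⟨C, hC, h⟩ := p.bound_of_continuous_normedSpace (continuous_seminorm p)
  exact ⟨C, hC.le, h⟩

theorem IsNorm.exists_norm_le {p : Seminorm ℝ V} (hp : IsNorm p) :
    ∃ C, 0 ≤ C ∧ ∀ x, ‖x‖ ≤ C * p x := by
  have : ProperSpace V := FiniteDimensional.proper_real V
  rcases (Metric.sphere (0 : V) 1).eq_empty_or_nonempty with he | hne
  -- An empty unit sphere means that the space is trivial.
  · refine ⟨0, le_rfl, fun x => ?_⟩
    by_contra! hx
    rw [zero_mul] at hx
    have : ‖x‖⁻¹ • x ∈ Metric.sphere (0 : V) 1 := by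
      rw [mem_sphere_zero_iff_norm, norm_smul, norm_inv, norm_norm, inv_mul_cancel₀ hx.ne']
    simp [he] at this
  · obtain ⟨v, hv, hmin⟩ := (isCompact_sphere (0 : V) 1).exists_isMinOn hne
      (continuous_seminorm p).continuousOn
    have hv1 : ‖v‖ = 1 := mem_sphere_zero_iff_norm.1 hv
    have hpos : 0 < p v := lt_of_le_of_ne (apply_nonneg p v) fun h => by
      rw [hp v h.symm, norm_zero] at hv1
      exact zero_ne_one hv1
    refine ⟨(p v)⁻¹, (inv_pos.2 hpos).le, fun x => ?_⟩
    rcases eq_or_ne x 0 with rfl | hx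
    · simp
    have hx0 : 0 < ‖x‖ := norm_pos_iff.2 hx
    have h1 : ‖x‖⁻¹ • x ∈ Metric.sphere (0 : V) 1 := by
      rw [mem_sphere_zero_iff_norm, norm_smul, norm_inv, norm_norm, inv_mul_cancel₀ hx0.ne']
    have h2 : p v ≤ p (‖x‖⁻¹ • x) := hmin h1
    rw [map_smul_eq_mul, norm_inv, norm_norm, le_inv_mul_iff₀ hx0] at h2
    rwa [le_inv_mul_iff₀ hpos, mul_comm]

end FiniteDimension

/-! ### Induced norms and matrix measures. -/

section Matrices

variable {ι κ : Type*} [Fintype κ]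

/-- Ensures that the real `sSup` in `inducedNorm` is a true upper bound and not the default value of
an unbounded set. -/
theorem inducedNorm_bddAbove (p : Seminorm ℝ (ι → ℝ)) {q : Seminorm ℝ (κ → ℝ)} (hq : IsNorm q)
    (A : Matrix ι κ ℝ) : BddAbove {r : ℝ | ∃ v : κ → ℝ, q v = 1 ∧ p (A.mulVec v) = r} := by
  obtain ⟨C, hC, h⟩ := exists_seminorm_le (p.comp A.mulVecLin)
  obtain ⟨C', hC', h'⟩ := hq.exists_norm_le
  refine ⟨C * C', ?_⟩
  rintro _ ⟨v, hv, rfl⟩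
  calc p (A.mulVec v) ≤ C * ‖v‖ := h v
    _ ≤ C * (C' * q v) := mul_le_mul_of_nonneg_left (h' v) hC
    _ = C * C' := by rw [hv, mul_one]

theorem seminorm_mulVec_le (p : Seminorm ℝ (ι → ℝ)) {q : Seminorm ℝ (κ → ℝ)} (hq : IsNorm q)
    (A : Matrix ι κ ℝ) (v : κ → ℝ) : p (A.mulVec v) ≤ inducedNorm p q A * q v := by
  rcases eq_or_ne v 0 with rfl | hv
  · simp
  have hpos : 0 < q v := lt_of_le_of_ne (apply_nonneg q v) fun h => hv (hq v h.symm)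
  have h1 : p (A.mulVec ((q v)⁻¹ • v)) ≤ inducedNorm p q A :=
    le_csSup (inducedNorm_bddAbove p hq A)
      ⟨(q v)⁻¹ • v, by rw [map_smul_eq_mul, norm_inv, Real.norm_of_nonneg hpos.le,
        inv_mul_cancel₀ hpos.ne'], rfl⟩
  rw [Matrix.mulVec_smul, map_smul_eq_mul, norm_inv, Real.norm_of_nonneg hpos.le,
    inv_mul_le_iff₀ hpos] at h1
  linarith

theorem inducedNorm_le {p : Seminorm ℝ (ι → ℝ)} {q : Seminorm ℝ (κ → ℝ)}
    {A : Matrix ι κ ℝ} {r : ℝ} (hr : 0 ≤ r) (h : ∀ v, q v = 1 → p (A.mulVec v) ≤ r) :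
    inducedNorm p q A ≤ r := by
  refine Real.sSup_le ?_ hr
  rintro _ ⟨v, hv, rfl⟩
  exact h v hv

theorem inducedNorm_nonneg (p : Seminorm ℝ (ι → ℝ)) (q : Seminorm ℝ (κ → ℝ))
    (A : Matrix ι κ ℝ) : 0 ≤ inducedNorm p q A :=
  Real.sSup_nonneg (by rintro _ ⟨v, -, rfl⟩; exact apply_nonneg p _)

variable [Fintype ι] [DecidableEq ι]

/-- The limit that defines the matrix measure exists. -/
theorem tendsto_matrixMeasure [Nonempty ι] {p : Seminorm ℝ (ι → ℝ)} (hp : IsNorm p)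
    (A : Matrix ι ι ℝ) :
    Tendsto (fun t : ℝ => (inducedNorm p p (1 + t • A) - 1) / t) (𝓝[>] 0)
      (𝓝 (matrixMeasure p A)) := by
  obtain ⟨v, hv⟩ : ∃ v, p v = 1 := by
    obtain ⟨w, hw⟩ := exists_ne (0 : ι → ℝ)
    have hpos : p w ≠ 0 := fun h => hw (hp w h)
    exact ⟨(p w)⁻¹ • w, by rw [map_smul_eq_mul, norm_inv,
      Real.norm_of_nonneg (apply_nonneg p w), inv_mul_cancel₀ hpos]⟩
  have hmul : ∀ (t : ℝ) (w : ι → ℝ), (1 + t • A).mulVec w = w + t • A.mulVec w := fun t w => by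
    rw [Matrix.add_mulVec, Matrix.one_mulVec, Matrix.smul_mulVec]
  -- For `s ≤ t`, `1 + s • A` is a convex combination of `1` and `1 + t • A`; convexity makes the
  -- difference quotients monotone, so the limit is their infimum once they are bounded below.
  have hmono : MonotoneOn (fun t : ℝ => (inducedNorm p p (1 + t • A) - 1) / t) (Ioi 0) := by
    intro s hs t ht hst
    have hs : 0 < s := hs
    have ht : 0 < t := ht
    have h0 := inducedNorm_nonneg p p (1 + t • A)
    have hθ : s / t ≤ 1 := (div_le_one ht).2 hst
    have h1 : inducedNorm p p (1 + s • A) ≤ (1 - s / t) + s / t * inducedNorm p p (1 + t • A) := by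
      refine inducedNorm_le (add_nonneg (sub_nonneg.2 hθ) (by positivity)) fun w hw => ?_
      have h2 : (1 + s • A).mulVec w = (1 - s / t) • w + (s / t) • (1 + t • A).mulVec w := by
        rw [hmul, hmul, smul_add, smul_smul, div_mul_cancel₀ _ ht.ne', sub_smul, one_smul]
        abel
      rw [h2]
      refine (map_add_le_add p _ _).trans ?_
      rw [map_smul_eq_mul, map_smul_eq_mul, Real.norm_of_nonneg (sub_nonneg.2 hθ),
        Real.norm_of_nonneg (by positivity), hw, mul_one]
      have := seminorm_mulVec_le p hp (1 + t • A) w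
      rw [hw, mul_one] at this
      gcongr
    show _ / s ≤ _ / t
    rw [div_le_div_iff₀ hs ht]
    have h3 : t * (s / t) = s := mul_div_cancel₀ _ ht.ne'
    nlinarith
  have hbdd : BddBelow ((fun t : ℝ => (inducedNorm p p (1 + t • A) - 1) / t) '' Ioi 0) := by
    refine ⟨-p (A.mulVec v), ?_⟩
    rintro _ ⟨t, ht, rfl⟩
    have ht : 0 < t := ht
    show _ ≤ _ / t
    rw [le_div_iff₀ ht]
    have h1 := seminorm_mulVec_le p hp (1 + t • A) v
    rw [hv, mul_one, hmul] at h1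
    have h2 : p v ≤ p (v + t • A.mulVec v) + p (t • A.mulVec v) := by
      have := map_sub_le_add p (v + t • A.mulVec v) (t • A.mulVec v)
      rwa [add_sub_cancel_right] at this
    rw [map_smul_eq_mul, Real.norm_of_nonneg ht.le, hv] at h2
    linarith
  have := hmono.tendsto_nhdsGT hbdd
  rw [matrixMeasure, this.limUnder_eq]
  exact this

theorem eventually_inducedNorm_le [Nonempty ι] {p : Seminorm ℝ (ι → ℝ)} (hp : IsNorm p)
    (A : Matrix ι ι ℝ) {ε : ℝ} (hε : 0 < ε) :
    ∀ᶠ s : ℝ in 𝓝[>] 0, inducedNorm p p (1 + s • A) ≤ 1 + s * (matrixMeasure p A + ε) := by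
  filter_upwards [(tendsto_matrixMeasure hp A).eventually_lt_const (lt_add_of_pos_right _ hε),
    self_mem_nhdsWithin] with s h1 hs
  rw [div_lt_iff₀ hs] at h1
  linarith

end Matrices

/-! ### The aggregated norm and the interconnection matrix. -/

section Interconnected

variable {m : ℕ} {n : Fin m → ℕ}

/-- The norm on the state space aggregated from the local norms and the network norm. -/
def aggregateSeminorm (net : Seminorm ℝ (Fin m → ℝ)) (hmono : IsMonotoneNorm net)
    (loc : (i : Fin m) → Seminorm ℝ (Fin (n i) → ℝ)) : Seminorm ℝ (State n) :=
  Seminorm.of (fun x => net fun i => loc i (x i))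
    (fun x y => (hmono ((fun i => loc i (x i)) + fun i => loc i (y i)) _
      (fun i => apply_nonneg (loc i) _) (fun i => map_add_le_add (loc i) (x i) (y i))).trans
        (map_add_le_add net _ _))
    (fun a x => by
      have : (fun i => loc i ((a • x) i)) = ‖a‖ • fun i => loc i (x i) := by
        ext i
        simp [map_smul_eq_mul]
      rw [this, map_smul_eq_mul, norm_norm])

theorem aggregateSeminorm_apply (net : Seminorm ℝ (Fin m → ℝ)) (hmono : IsMonotoneNorm net)
    (loc : (i : Fin m) → Seminorm ℝ (Fin (n i) → ℝ)) (x : State n) :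
    aggregateSeminorm net hmono loc x = net fun i => loc i (x i) := rfl

theorem isNorm_aggregateSeminorm {net : Seminorm ℝ (Fin m → ℝ)} (hnet : IsNorm net)
    (hmono : IsMonotoneNorm net) {loc : (i : Fin m) → Seminorm ℝ (Fin (n i) → ℝ)}
    (hloc : ∀ i, IsNorm (loc i)) : IsNorm (aggregateSeminorm net hmono loc) := by
  intro x hx
  ext1 i
  exact hloc i _ (congrFun (hnet _ hx) i)

theorem fderiv_apply_eq_sum_jacobianBlock (f : ℝ → State n → State n) (t : ℝ) (x z : State n)
    (i : Fin m) : fderiv ℝ (f t) x z i = ∑ j, (jacobianBlock f t x i j).mulVec (z j) := by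
  have h1 : z = ∑ j, ∑ b, z j b • (Pi.single j (Pi.single b (1 : ℝ)) : State n) := by
    have h2 : ∀ j, ∑ b, z j b • (Pi.single j (Pi.single b (1 : ℝ)) : State n)
        = Pi.single j (z j) := by
      intro j
      have h3 : z j = ∑ b, z j b • (Pi.single b (1 : ℝ) : Fin (n j) → ℝ) := by
        simpa using (pi_eq_sum_univ' (z j))
      conv_rhs => rw [h3]
      rw [← LinearMap.coe_single ℝ (fun j : Fin m => Fin (n j) → ℝ) j, map_sum]
      simp
    simp_rw [h2]
    exact (Finset.univ_sum_single z).symm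
  conv_lhs => rw [h1]
  ext a
  simp only [map_sum, map_smul, Finset.sum_apply, Pi.smul_apply, smul_eq_mul, Matrix.mulVec,
    dotProduct, jacobianBlock, Matrix.of_apply]
  exact Finset.sum_congr rfl fun j _ => Finset.sum_congr rfl fun b _ => mul_comm _ _

/-- The logarithmic norm of the Jacobian with respect to the aggregated norm is bounded by the
matrix measure of the interconnection matrix. -/
theorem logNormLE_aggregateSeminorm (hm : 0 < m) (hn : ∀ i, 1 ≤ n i)
    {net : Seminorm ℝ (Fin m → ℝ)} (hnet : IsNorm net)
    (hmono : IsMonotoneNorm net) {loc : (i : Fin m) → Seminorm ℝ (Fin (n i) → ℝ)}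
    (hloc : ∀ i, IsNorm (loc i)) {f : ℝ → State n → State n} {t c : ℝ} {x : State n}
    (hc : matrixMeasure net (interconnectionMatrix loc f t x) ≤ c) :
    LogNormLE (aggregateSeminorm net hmono loc) (fderiv ℝ (f t) x) c := by
  intro z ε hε
  have : Nonempty (Fin m) := ⟨⟨0, hm⟩⟩
  have : ∀ i, Nonempty (Fin (n i)) := fun i => ⟨⟨0, hn i⟩⟩
  set ζ : Fin m → ℝ := fun i => loc i (z i) with hζ
  have hζ0 : ∀ i, 0 ≤ ζ i := fun i => apply_nonneg (loc i) _
  have hN0 : 0 ≤ net ζ := apply_nonneg net _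
  set A := interconnectionMatrix loc f t x with hA
  -- Half of `ε` pays for the error in the local matrix measures, half for the network one; the `+
  -- 1` covers `net ζ = 0`.
  set η := ε / (2 * (net ζ + 1)) with hη
  have hηpos : 0 < η := by positivity
  have hηle : 2 * η * net ζ ≤ ε := by
    have h1 : 2 * η * (net ζ + 1) = ε := by rw [hη]; field_simp
    nlinarith
  filter_upwards [eventually_inducedNorm_le hnet A hηpos,
    eventually_all.2 fun i => eventually_inducedNorm_le (hloc i) (jacobianBlock f t x i i) hηpos,
    self_mem_nhdsWithin] with s h1 h2 hs
  have hs : 0 < s := hs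
  -- The diagonal block is kept together with the identity, so that it costs its matrix measure; the
  -- other blocks cost their induced norms.
  have hcomp : (fun i => loc i ((z + s • fderiv ℝ (f t) x z) i)) ≤
      (1 + s • A).mulVec ζ + (s * η) • ζ := by
    intro i
    have h3 : (z + s • fderiv ℝ (f t) x z) i = (1 + s • jacobianBlock f t x i i).mulVec (z i) +
        s • ∑ j ∈ Finset.univ.erase i, (jacobianBlock f t x i j).mulVec (z j) := by
      rw [Pi.add_apply, Pi.smul_apply, fderiv_apply_eq_sum_jacobianBlock,
        ← Finset.add_sum_erase _ _ (Finset.mem_univ i), smul_add, Matrix.add_mulVec,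
        Matrix.one_mulVec, Matrix.smul_mulVec, add_assoc]
    have h4 : loc i ((1 + s • jacobianBlock f t x i i).mulVec (z i)) ≤
        (1 + s * (A i i + η)) * ζ i := by
      refine (seminorm_mulVec_le (loc i) (hloc i) _ _).trans
        (mul_le_mul_of_nonneg_right ((h2 i).trans (le_of_eq ?_)) (hζ0 i))
      simp [hA, interconnectionMatrix]
    have h5 : loc i (∑ j ∈ Finset.univ.erase i, (jacobianBlock f t x i j).mulVec (z j)) ≤
        ∑ j ∈ Finset.univ.erase i, A i j * ζ j := by
      refine (Finset.le_sum_of_subadditive (loc i) (map_zero _).le (map_add_le_add _) _ _).trans (Finset.sum_le_sum fun j hj => ?_)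
      refine (seminorm_mulVec_le (loc i) (hloc j) _ _).trans (le_of_eq ?_)
      simp [hA, interconnectionMatrix, (Finset.ne_of_mem_erase hj).symm, hζ]
    have h6 : ((1 + s • A).mulVec ζ + (s * η) • ζ) i = (1 + s * (A i i + η)) * ζ i +
        s * ∑ j ∈ Finset.univ.erase i, A i j * ζ j := by
      rw [Pi.add_apply, Matrix.add_mulVec, Matrix.one_mulVec, Matrix.smul_mulVec, Pi.add_apply,
        Pi.smul_apply, Pi.smul_apply, Matrix.mulVec, dotProduct,
        ← Finset.add_sum_erase _ _ (Finset.mem_univ i), smul_eq_mul, smul_eq_mul]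
      ring
    rw [h6]
    change loc i ((z + s • fderiv ℝ (f t) x z) i) ≤ _
    rw [h3]
    refine (map_add_le_add (loc i) _ _).trans (add_le_add h4 ?_)
    rw [map_smul_eq_mul, Real.norm_of_nonneg hs.le]
    exact mul_le_mul_of_nonneg_left h5 hs.le
  rw [aggregateSeminorm_apply, aggregateSeminorm_apply]
  have h7 := (hmono _ _ (fun i => apply_nonneg (loc i) _) hcomp).trans (map_add_le_add net _ _)
  rw [map_smul_eq_mul, Real.norm_of_nonneg (mul_pos hs hηpos).le] at h7
  have h8 : net ((1 + s • A).mulVec ζ) ≤ (1 + s * (c + η)) * net ζ := by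
    refine (seminorm_mulVec_le net hnet _ _).trans (mul_le_mul_of_nonneg_right (h1.trans ?_) hN0)
    gcongr
  have h9 := mul_le_mul_of_nonneg_left hηle hs.le
  calc _ ≤ _ := h7
    _ ≤ (1 + s * (c + η)) * net ζ + s * η * net ζ := by gcongr
    _ ≤ (1 + s * c) * net ζ + s * ε := by linarith

end Interconnected

/-! ### Reduction of entropy to a fixed resolution. -/

section Systems

variable {E : Type*} [NormedAddCommGroup E] [NormedSpace ℝ E]

theorem spanningNumber_anti (p : Seminorm ℝ E) (f : ℝ → E → E) (t₀ T : ℝ) (K : Set E) :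
    Antitone fun ε => spanningNumber p f t₀ ε T K := by
  intro ε ε' h
  refine le_iInf₂ fun A hA => iInf₂_le A ⟨hA.1, fun y hy => ?_⟩
  obtain ⟨x, hx, hlt⟩ := hA.2 y hy
  exact ⟨x, hx, fun t ht => (hlt t ht).trans_le h⟩

/-- The entropy is bounded by any bound of the exponential growth rates at fixed resolution. -/
theorem topEntropy_le {p : Seminorm ℝ E} {f : ℝ → E → E} {t₀ : ℝ} {K : Set E} {B : EReal}
    (h : ∀ ε : ℝ, 0 < ε → limsup (fun T : ℝ => ((1 / T : ℝ) : EReal) *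
      ENNReal.log ((spanningNumber p f t₀ ε T K : ℕ∞) : ENNReal)) atTop ≤ B) :
    topEntropy p f t₀ K ≤ B := by
  have hanti : Antitone fun ε : ℝ => limsup (fun T : ℝ => ((1 / T : ℝ) : EReal) *
      ENNReal.log ((spanningNumber p f t₀ ε T K : ℕ∞) : ENNReal)) atTop := by
    intro ε ε' hε
    refine limsup_le_limsup ?_
    filter_upwards [eventually_ge_atTop (0 : ℝ)] with T hT
    refine mul_le_mul_of_nonneg_left (ENNReal.log_monotone ?_)
      (EReal.coe_nonneg.2 (one_div_nonneg.2 hT))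
    exact ENat.toENNReal_le.2 (spanningNumber_anti p f t₀ T K hε)
  -- By monotonicity the limit exists and is the supremum over `ε > 0`.
  rw [topEntropy, (hanti.tendsto_nhdsGT 0).limUnder_eq]
  refine sSup_le ?_
  rintro _ ⟨ε, hε, rfl⟩
  exact h ε hε

end Systems

/-! ### Grid coverings and the entropy bound. -/

section Covering

variable {m : ℕ} {n : Fin m → ℕ}

/-- A set in a cube of half side `R` has a `δ`-net of at most `(2 ⌈R / δ⌉ + 1) ^ dim` points. -/
theorem exists_net_of_norm_le {K : Set (State n)} {R δ : ℝ} (hR : ∀ x ∈ K, ‖x‖ ≤ R)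
    (hδ : 0 < δ) :
    ∃ A ⊆ K, A.encard ≤ (((2 * ⌈R / δ⌉₊ + 1) ^ ∑ i, n i : ℕ) : ℕ∞) ∧
      ∀ y ∈ K, ∃ x ∈ A, ‖y - x‖ ≤ δ := by
  set g : State n → ((Σ i, Fin (n i)) → ℤ) := fun x j => ⌊x j.1 j.2 / δ⌋ with hg
  -- One representative per occupied grid cell, taken in `K` because spanning sets must lie in `K`.
  obtain ⟨A, hAK, hA⟩ := K.exists_subset_bijOn g
  refine ⟨A, hAK, ?_, fun y hy => ?_⟩
  · set k : ℕ := ⌈R / δ⌉₊ with hk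
    have hsub : g '' A ⊆
        (Fintype.piFinset fun _ : (Σ i, Fin (n i)) => Finset.Icc (-(k : ℤ)) k : Finset _) := by
      rintro _ ⟨x, hx, rfl⟩
      rw [Finset.mem_coe, Fintype.mem_piFinset]
      intro j
      have h1 : |x j.1 j.2| ≤ R :=
        ((norm_le_pi_norm (x j.1) j.2).trans (norm_le_pi_norm x j.1)).trans (hR x (hAK hx))
      have h2 : |x j.1 j.2 / δ| ≤ k := by
        rw [abs_div, abs_of_pos hδ]
        exact (div_le_div_of_nonneg_right h1 hδ.le).trans (Nat.le_ceil _)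
      rw [abs_le] at h2
      rw [Finset.mem_Icc]
      constructor
      · rw [Int.le_floor]; push_cast; exact h2.1
      · exact Int.floor_le_iff.2 (by push_cast; linarith [h2.2])
    rw [← hA.injOn.encard_image]
    refine (encard_le_encard hsub).trans ?_
    rw [encard_coe_eq_coe_finsetCard, Fintype.card_piFinset, Finset.prod_const, Int.card_Icc,
      Finset.card_univ, Fintype.card_sigma]
    simp only [Fintype.card_fin]
    refine le_of_eq ?_
    congr 2
    omega
  · obtain ⟨x, hx, hxy⟩ := hA.surjOn (mem_image_of_mem g hy)
    refine ⟨x, hx, ?_⟩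
    refine (pi_norm_le_iff_of_nonneg hδ.le).2 fun i => (pi_norm_le_iff_of_nonneg hδ.le).2
      fun a => ?_
    have h1 : ⌊x i a / δ⌋ = ⌊y i a / δ⌋ := congrFun hxy ⟨i, a⟩
    have h2 := Int.abs_sub_lt_one_of_floor_eq_floor h1.symm
    rw [← sub_div, abs_div, abs_of_pos hδ, div_lt_one hδ] at h2
    exact h2.le

/-- If solutions separate at most at the exponential rate `c`, then the entropy is at most `c`
times the dimension. -/
theorem topEntropy_le_of_norm_flow_sub_le {p : Seminorm ℝ (State n)} {f : ℝ → State n → State n}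
    {t₀ : ℝ} {K : Set (State n)} (hK : Bornology.IsBounded K) {D c : ℝ} (hD : 0 < D) (hc : 0 ≤ c)
    (h : ∀ T, 0 ≤ T → ∀ x ∈ K, ∀ y ∈ K, ∀ t ∈ Icc t₀ (t₀ + T),
      p (flow f t t₀ x - flow f t t₀ y) ≤ D * Real.exp (c * T) * ‖x - y‖) :
    topEntropy p f t₀ K ≤ (((∑ i, n i : ℕ) * c : ℝ) : EReal) := by
  obtain ⟨R, hR0, hR⟩ := hK.exists_pos_norm_le
  set d := ∑ i, n i with hd
  refine topEntropy_le fun ε hε => ?_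
  -- With mesh `δ = ε / (2 * D * e)`, each factor satisfies `2 * ⌈R / δ⌉₊ + 1 ≤ 2 * (R / δ) + 3 ≤ Q
  -- * e`, since `1 ≤ e`.
  set Q := 4 * R * D / ε + 3 with hQ
  have hQpos : 0 < Q := by positivity
  have hlim : Tendsto (fun T : ℝ => ((d * Real.log Q * T⁻¹ + d * c : ℝ) : EReal)) atTop
      (𝓝 ((d * c : ℝ) : EReal)) := by
    refine EReal.tendsto_coe.2 ?_
    simpa using (tendsto_inv_atTop_zero.const_mul (d * Real.log Q)).add_const (d * c)
  rw [← hlim.limsup_eq]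
  refine limsup_le_limsup ?_
  filter_upwards [eventually_gt_atTop (0 : ℝ)] with T hT
  set e := Real.exp (c * T) with he
  have he1 : 1 ≤ e := Real.one_le_exp (by positivity)
  have he0 : 0 < e := Real.exp_pos _
  set δ := ε / (2 * D * e) with hδ
  have hδpos : 0 < δ := by positivity
  obtain ⟨A, hAK, hcard, hnet⟩ := exists_net_of_norm_le hR hδpos
  have hspan : IsSpanning p f t₀ ε T K A := by
    refine ⟨hAK, fun y hy => ?_⟩
    obtain ⟨x, hx, hxy⟩ := hnet y hy
    refine ⟨x, hx, fun t ht => (h T hT.le y hy x (hAK hx) t ht).trans_lt ?_⟩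
    calc D * e * ‖y - x‖ ≤ D * e * δ := by gcongr
      _ = ε / 2 := by rw [hδ]; field_simp
      _ < ε := half_lt_self hε
  have hS : spanningNumber p f t₀ ε T K ≤ (((2 * ⌈R / δ⌉₊ + 1) ^ d : ℕ) : ℕ∞) :=
    (iInf₂_le A hspan).trans hcard
  have hceil : ((2 * ⌈R / δ⌉₊ + 1 : ℕ) : ℝ) ≤ Q * e := by
    have h1 : (⌈R / δ⌉₊ : ℝ) < R / δ + 1 := Nat.ceil_lt_add_one (by positivity)
    have h2 : R / δ = 2 * R * D / ε * e := by rw [hδ]; field_simp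
    push_cast
    rw [hQ, add_mul]
    have h3 : 4 * R * D / ε * e = 2 * (R / δ) := by rw [h2]; ring
    linarith
  have hSE : ((spanningNumber p f t₀ ε T K : ℕ∞) : ENNReal) ≤ ENNReal.ofReal ((Q * e) ^ d) := by
    refine (ENat.toENNReal_le.2 hS).trans ?_
    rw [ENat.toENNReal_coe, ← ENNReal.ofReal_natCast]
    refine ENNReal.ofReal_le_ofReal ?_
    rw [Nat.cast_pow]
    exact pow_le_pow_left₀ (Nat.cast_nonneg _) hceil d
  have hlog := ENNReal.log_monotone hSE
  rw [ENNReal.log_ofReal_of_pos (by positivity), Real.log_pow,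
    Real.log_mul hQpos.ne' he0.ne', he, Real.log_exp] at hlog
  calc _ ≤ ((1 / T : ℝ) : EReal) * ((d * (Real.log Q + c * T) : ℝ) : EReal) :=
        mul_le_mul_of_nonneg_left hlog (EReal.coe_nonneg.2 (one_div_nonneg.2 hT.le))
    _ = _ := by
        rw [← EReal.coe_mul]
        congr 1
        field_simp

end Covering

/-! ### Assembly of the bound. -/

section Interconnected

variable {m : ℕ} {n : Fin m → ℕ}

/-- A strict bound on the infimum and the limsup yields actual times `t₁` and `t₂` after which `c`
bounds the matrix measure. The flow up to `max t₁ t₂` costs only a Lipschitz constant, which the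
growth rate does not see. -/
theorem topEntropy_le_of_muHatStar_lt (hm : 0 < m) (hn : ∀ i, 1 ≤ n i)
    {f : ℝ → State n → State n} {t₀ : ℝ} (hf : RegularFrom t₀ f) (hfc : ForwardComplete t₀ f)
    {K : Set (State n)} (hK : IsCompact K) (p : Seminorm ℝ (State n))
    {loc : (i : Fin m) → Seminorm ℝ (Fin (n i) → ℝ)} (hloc : ∀ i, IsNorm (loc i))
    {net : Seminorm ℝ (Fin m → ℝ)} (hnet : IsNorm net) (hmono : IsMonotoneNorm net)
    {c : ℝ} (hc : 0 ≤ c) (hlt : muHatStar net loc f t₀ K < c) :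
    topEntropy p f t₀ K ≤ (((∑ i, n i : ℕ) * c : ℝ) : EReal) := by
  obtain ⟨t₁, h⟩ := iInf_lt_iff.1 hlt
  obtain ⟨ht₁, h⟩ := iInf_lt_iff.1 h
  obtain ⟨t₂, ht₂⟩ := eventually_atTop.1 (eventually_lt_of_limsup_lt h)
  set a := max t₁ t₂ with ha
  have hta : t₁ ≤ a := le_max_left _ _
  set N := aggregateSeminorm net hmono loc with hN
  obtain ⟨C, hC, hNC⟩ := exists_seminorm_le N
  obtain ⟨C', hC', hNC'⟩ := (isNorm_aggregateSeminorm hnet hmono hloc : IsNorm N).exists_norm_le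
  obtain ⟨Cp, hCp, hp⟩ := exists_seminorm_le p
  obtain ⟨R, hR⟩ := hfc.exists_norm_flow_le hf le_rfl t₁ hK
  -- Compactness of the hull is not needed: Lipschitz constants are taken on a ball containing it.
  have hco : convexHull ℝ (reachableSet f t₁ t₀ K) ⊆ Metric.closedBall 0 R := by
    refine convexHull_min ?_ (convex_closedBall _ _)
    rintro _ ⟨x, hx, rfl⟩
    exact mem_closedBall_zero_iff.2 (hR x hx t₁ (right_mem_Icc.2 ht₁))
  have hlog : ∀ t, a ≤ t → ∀ v ∈ convexHull ℝ (reachableSet f t₁ t₀ K),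
      LogNormLE N (fderiv ℝ (f t) (flow f t t₁ v)) c := by
    intro t ht v hv
    refine logNormLE_aggregateSeminorm hm hn hnet hmono hloc (EReal.coe_le_coe_iff.1 ?_)
    exact (le_iSup₂ (f := fun v (_ : v ∈ convexHull ℝ (reachableSet f t₁ t₀ K)) =>
      ((matrixMeasure net (interconnectionMatrix loc f t (flow f t t₁ v)) : ℝ) : EReal)) v
        hv).trans (ht₂ t ((le_max_right _ _).trans ht)).le
  obtain ⟨M, hM, hsep⟩ := exists_norm_flow_sub_le_mul_exp hf hfc (continuous_seminorm N) hC hNC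
    hC' hNC' ht₁ hta hc (convex_convexHull ℝ _) hco (isCompact_closedBall 0 R) hlog
  obtain ⟨M₁, hM₁, hlip⟩ := hfc.exists_flow_lipschitz hf le_rfl a hK
  refine topEntropy_le_of_norm_flow_sub_le hK.isBounded (D := Cp * (M₁ + M * M₁) + 1)
    (by positivity) hc fun T hT x hx y hy t ht => ?_
  have he : 1 ≤ Real.exp (c * T) := Real.one_le_exp (by positivity)
  have hMM : 0 ≤ M * M₁ := mul_nonneg hM hM₁
  suffices hmain : ‖flow f t t₀ x - flow f t t₀ y‖ ≤
      (M₁ + M * M₁) * Real.exp (c * T) * ‖x - y‖ by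
    calc _ ≤ Cp * ‖flow f t t₀ x - flow f t t₀ y‖ := hp _
      _ ≤ Cp * ((M₁ + M * M₁) * Real.exp (c * T) * ‖x - y‖) :=
        mul_le_mul_of_nonneg_left hmain hCp
      _ = Cp * (M₁ + M * M₁) * Real.exp (c * T) * ‖x - y‖ := by ring
      _ ≤ _ := by gcongr; linarith
  rcases le_total t a with hle | hge
  · refine (hlip x hx y hy t ⟨ht.1, hle⟩).trans
      (mul_le_mul_of_nonneg_right ?_ (norm_nonneg _))
    nlinarith
  · have h1 := hsep t hge _ (subset_convexHull ℝ _ (mem_image_of_mem _ hx)) _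
      (subset_convexHull ℝ _ (mem_image_of_mem _ hy))
    rw [hfc.flow_flow hf le_rfl ht₁ (hta.trans hge), hfc.flow_flow hf le_rfl ht₁ (hta.trans hge)]
      at h1
    have h2 : Real.exp (c * (t - a)) ≤ Real.exp (c * T) :=
      Real.exp_le_exp.2 (mul_le_mul_of_nonneg_left (by linarith [ht.2, ht₁.trans hta]) hc)
    calc _ ≤ _ := h1
      _ ≤ M * Real.exp (c * T) * (M₁ * ‖x - y‖) := by
        gcongr
        exact hlip x hx y hy t₁ ⟨ht₁, hta⟩
      _ = M * M₁ * Real.exp (c * T) * ‖x - y‖ := by ring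
      _ ≤ _ := by gcongr; linarith

end Interconnected

end TVEntropy

end

theorem corollary4 (m : ℕ) (hm : 2 ≤ m) (n : Fin m → ℕ) (hn : ∀ i, 1 ≤ n i)
    (f : ℝ → TVEntropy.State n → TVEntropy.State n) (t₀ : ℝ)
    (hf : TVEntropy.RegularFrom t₀ f) (hfc : TVEntropy.ForwardComplete t₀ f)
    (K : Set (TVEntropy.State n)) (hK : IsCompact K) (hKint : (interior K).Nonempty)
    (p : Seminorm ℝ (TVEntropy.State n)) (hp : TVEntropy.IsNorm p)
    (loc : (i : Fin m) → Seminorm ℝ (Fin (n i) → ℝ)) (hloc : ∀ i, TVEntropy.IsNorm (loc i))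
    (net : Seminorm ℝ (Fin m → ℝ)) (hnet : TVEntropy.IsNorm net)
    (hnet_mono : TVEntropy.IsMonotoneNorm net) :
    TVEntropy.topEntropy p f t₀ K ≤
      ((∑ i, n i : ℕ) : EReal) * max (TVEntropy.muHatStar net loc f t₀ K) 0 := by

  have hd : 0 < ∑ i, n i := Finset.sum_pos (fun i _ => hn i) ⟨⟨0, by omega⟩, Finset.mem_univ _⟩
  set d := ∑ i, n i
  have hbound : ∀ c : ℝ, 0 ≤ c → TVEntropy.muHatStar net loc f t₀ K < c →
      TVEntropy.topEntropy p f t₀ K ≤ ((d * c : ℝ) : EReal) := fun c hc hlt =>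
    TVEntropy.topEntropy_le_of_muHatStar_lt (by omega) hn hf hfc hK p hloc hnet hnet_mono hc hlt
  have hmax : (0 : EReal) ≤ max (TVEntropy.muHatStar net loc f t₀ K) 0 := le_max_right _ _
  induction hμ : max (TVEntropy.muHatStar net loc f t₀ K) 0 with
  | bot => rw [hμ] at hmax; simp at hmax
  | top =>
    -- Positive dimension matters here, since `0 * ⊤ = 0` in `EReal`.
    rw [EReal.mul_top_of_pos (by exact_mod_cast hd)]
    exact le_top
  | coe c =>
    have hc : 0 ≤ c := by rw [hμ] at hmax; exact_mod_cast hmax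
    -- `hbound` needs a strict inequality, so `c` is approached from the right.
    have hlim : Tendsto (fun r : ℝ => ((d * r : ℝ) : EReal)) (𝓝[>] c) (𝓝 ((d * c : ℝ) : EReal)) :=
      EReal.tendsto_coe.2 (((continuous_const.mul continuous_id).tendsto c).mono_left
        nhdsWithin_le_nhds)
    have hle := ge_of_tendsto hlim (by
      filter_upwards [self_mem_nhdsWithin] with r hr
      exact hbound r (hc.trans (le_of_lt hr))
        ((le_max_left _ 0).trans_lt (hμ ▸ EReal.coe_lt_coe_iff.2 hr)))
    rw [EReal.coe_mul] at hle
    exact_mod_cast hle
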